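/- For a positive integer $n$, let $S(n)$ denote the largest real number $a$ such that a (closed) square of edge length $a$ in the Euclidean plane can be covered by $n$ (closed) unit squares, which may be placed in arbitrary position (translated and rotated freely). Then $S(5)=2$; that is, a square of edge length $2$ can be covered by five unit squares, and no square of edge length greater than $2$ can. Furthermore, if $\mathcal{F}$ is a family of five unit squares covering a square $S$ of edge length $2$, then at least one element of $\mathcal{F}$ has sides parallel to those of $S$. -/

import Mathlib

/-- A (closed, solid, nondegenerate) square in the Euclidean plane, in arbitrary position: it is
given by one of its vertices, the two orthonormal directions of the sides that start there, and
its edge length. -/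
structure PlaneSquare where
  /-- a vertex of the square -/
  corner : EuclideanSpace ℝ (Fin 2)
  /-- unit direction of one side starting at `corner` -/
  u : EuclideanSpace ℝ (Fin 2)
  /-- unit direction of the other side starting at `corner` -/
  v : EuclideanSpace ℝ (Fin 2)
  /-- the edge length -/
  side : ℝ
  norm_u : ‖u‖ = 1
  norm_v : ‖v‖ = 1
  inner_u_v : inner ℝ u v = 0
  side_pos : 0 < side

namespace PlaneSquare

/-- The set of points of the square (interior and boundary). -/
def carrier (Q : PlaneSquare) : Set (EuclideanSpace ℝ (Fin 2)) :=
  {p | ∃ x y : ℝ, 0 ≤ x ∧ x ≤ Q.side ∧ 0 ≤ y ∧ y ≤ Q.side ∧ p = Q.corner + x • Q.u + y • Q.v}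

/-- The squares `Q` and `R` have parallel sides: the two directions of the sides of `Q` are, in
some order, the two directions of the sides of `R`, where a direction is the line through the
origin spanned by a vector. -/
def SidesParallel (Q R : PlaneSquare) : Prop :=
  (Submodule.span ℝ {Q.u} = Submodule.span ℝ {R.u} ∧
    Submodule.span ℝ {Q.v} = Submodule.span ℝ {R.v}) ∨
  (Submodule.span ℝ {Q.u} = Submodule.span ℝ {R.v} ∧
    Submodule.span ℝ {Q.v} = Submodule.span ℝ {R.u})

/-- The family `F` consists of unit squares and covers the square `Q`. -/
def IsUnitCover {n : ℕ} (F : Fin n → PlaneSquare) (Q : PlaneSquare) : Prop :=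
  (∀ i, (F i).side = 1) ∧ Q.carrier ⊆ ⋃ i, (F i).carrier

/-- The set of all edge lengths `a` such that a square of edge length `a` can be covered by `n`
unit squares. Its greatest element is the number `S(n)`. -/
def coverableLengths (n : ℕ) : Set ℝ :=
  {a | ∃ Q : PlaneSquare, Q.side = a ∧ ∃ F : Fin n → PlaneSquare, IsUnitCover F Q}

end PlaneSquare

/-!
Carry the big square to `[-1, 1]²`, so that the small squares have edge length at most `1`, and
suppose that none of edge length `1` has sides parallel to the axes. Then each of them fits into a
tilted unit square (a smaller one with sides parallel to the axes, after a slight rotation). Such a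
piece is too thin to meet two opposite sides, so four of the five hold one vertex each, and every
gap which these leave on a side is covered by the fifth, `E`.

As `E` does not meet two opposite sides, two adjacent sides have no gap. A piece at a vertex cuts
out of the two sides there segments of total length less than `2`; going around the boundary, this
forces the gaps of the other two sides, if both exist, to overlap after a quarter turn, which is
impossible since they both lie in `E`. So three sides have no gap.

Let the upper side be the remaining one, and let the lower left piece hold the midpoint of the
lower side. Then no piece at a vertex contains the centre, and `E` joins a segment of the
horizontal midline ending at the centre to the gap on the upper side. Parametrizing the directions
of `E` and of the upper left piece by tangents of half angles shows that `E` would have to be wider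
than `1`.
-/

open Set Topology

theorem exists_forall_mem_iff_le_of_isClosed {X : Type*} [ConditionallyCompleteLinearOrder X]
    [TopologicalSpace X] [OrderTopology X] {S : Set X} (hcl : IsClosed S) (hoc : S.OrdConnected)
    {a b : X} (hab : a ≤ b) (ha : a ∈ S) :
    ∃ m ∈ Icc a b, ∀ x ∈ Icc a b, x ∈ S ↔ x ≤ m := by
  obtain ⟨m, ⟨hm, hmS⟩, hmax⟩ :=
    (isCompact_Icc.inter_right hcl).exists_isGreatest ⟨a, left_mem_Icc.2 hab, ha⟩
  exact ⟨m, hm, fun x hx => ⟨fun hxS => hmax ⟨hx, hxS⟩, fun hxm => hoc.out ha hmS ⟨hx.1, hxm⟩⟩⟩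

theorem le_of_forall_Icc_le_or_ge {X : Type*} [LinearOrder X] [DenselyOrdered X] {a b l r : X}
    (hl : a ≤ l) (hr : r ≤ b) (h : ∀ x ∈ Icc a b, x ≤ l ∨ r ≤ x) : r ≤ l := by
  by_contra! hlt
  obtain ⟨x, hlx, hxr⟩ := exists_between hlt
  rcases h x ⟨hl.trans hlx.le, hxr.le.trans hr⟩ with hx | hx
  exacts [hx.not_gt hlx, hx.not_gt hxr]

theorem Icc_subset_of_Ioo_subset_of_isClosed {X : Type*} [LinearOrder X] [TopologicalSpace X]
    [OrderTopology X] [DenselyOrdered X] {S : Set X} (hS : IsClosed S) {a b : X} (hab : a < b)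
    (h : Ioo a b ⊆ S) : Icc a b ⊆ S := by
  rw [← closure_Ioo hab.ne]
  exact closure_minimal h hS

theorem exists_forall_mem_range_or_eq {ι κ : Type*} [Fintype ι] [Fintype κ] {f : ι → κ}
    (hf : Function.Injective f) (hcard : Fintype.card κ = Fintype.card ι + 1) :
    ∃ k, ∀ j, j ∈ range f ∨ j = k := by
  classical
  have hcompl : (Finset.univ.image f)ᶜ.card = 1 := by
    rw [Finset.card_compl, Finset.card_image_of_injective _ hf, Finset.card_univ, hcard,
      Nat.add_sub_cancel_left]
  obtain ⟨k, hk⟩ := Finset.card_eq_one.1 hcompl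
  refine ⟨k, fun j => or_iff_not_imp_left.2 fun hj => ?_⟩
  have : j ∈ (Finset.univ.image f)ᶜ := by simpa using hj
  rwa [hk, Finset.mem_singleton] at this

theorem lt_one_and_lt_one_of_sq_add_sq_eq_one {c s : ℝ} (hc : 0 < c) (hs : 0 < s)
    (h : c ^ 2 + s ^ 2 = 1) : c < 1 ∧ s < 1 := by
  constructor <;> nlinarith

theorem one_lt_of_mul_one_add_le_one {c s x : ℝ} (hc : 0 < c) (hs : 0 < s)
    (hcs : c ^ 2 + s ^ 2 = 1) (hsc : s ≤ c) (h : c * (1 + x) ≤ 1) :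
    1 < s * (1 + x) + c * (1 - x) := by
  by_contra! hle
  have hs_le : s ≤ 2 * c * (1 - c) := by linear_combination c * hle + (c - s) * h
  have hs_mul : s * (1 + c) ≤ s * (2 * c * s) := by
    linear_combination (1 + c) * hs_le - 2 * c * hcs
  have hc_le : 1 + c ≤ 2 * c * s := le_of_mul_le_mul_left hs_mul hs
  linarith [sq_nonneg (c - s)]

theorem exists_half_tan {c s : ℝ} (hc : 0 < c) (hs : 0 < s) (hcs : c ^ 2 + s ^ 2 = 1) :
    ∃ t, 0 < t ∧ t < 1 ∧ c * (1 + t ^ 2) = 1 - t ^ 2 ∧ s * (1 + t ^ 2) = 2 * t := by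
  obtain ⟨-, hs1⟩ := lt_one_and_lt_one_of_sq_add_sq_eq_one hc hs hcs
  refine ⟨s / (1 + c), by positivity, (div_lt_one (by positivity)).2 (by linarith), ?_, ?_⟩
  · field_simp
    linear_combination (c + 1) * hcs
  · field_simp
    linear_combination hcs

-- Here and below `τ` is the tangent of half the angle between the horizontal and the upper left
-- piece, and `u` plays the same role for the piece `E`, up to swapping the axes.
theorem mul_lt_of_tan_bound {τ α : ℝ} (hτ : 0 < τ) (hτ1 : τ < 1) (hα : 0 < α)
    (hA : 2 * α * τ < (1 - τ) ^ 2) (hατ : α * (1 - τ ^ 2) ≤ 2 * τ ^ 2) :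
    (2 - τ - α) * ((1 - τ) ^ 2 - 2 * α * τ) < 2 * (1 - τ - α) * (1 - τ ^ 2) := by
  suffices hkey : 2 * α * (1 - 2 * τ) ≤ 3 * τ * (1 - τ) ^ 2 by
    linarith [mul_pos hα (sub_pos.2 hA)]
  have hsq : 0 < (1 - τ) ^ 2 := pow_pos (sub_pos.2 hτ1) 2
  rcases le_total (1 / 2) τ with hhalf | hhalf
  · nlinarith
  have hτ2 : 3 / 4 ≤ 1 - τ ^ 2 := by nlinarith
  refine le_of_mul_le_mul_right ?_ (by linarith : 0 < 1 - τ ^ 2)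
  calc 2 * α * (1 - 2 * τ) * (1 - τ ^ 2)
      = 2 * (1 - 2 * τ) * (α * (1 - τ ^ 2)) := by ring
    _ ≤ 2 * (1 - 2 * τ) * (2 * τ ^ 2) := by gcongr; linarith
    _ = τ * (4 * τ * (1 - 2 * τ)) := by ring
    _ ≤ τ * (1 / 2) := by gcongr; linarith [sq_nonneg (4 * τ - 1)]
    _ ≤ τ * (3 * (1 / 2) ^ 2 * (3 / 4)) := by gcongr; norm_num
    _ ≤ τ * (3 * (1 - τ) ^ 2 * (1 - τ ^ 2)) := by gcongr; linarith
    _ = 3 * τ * (1 - τ) ^ 2 * (1 - τ ^ 2) := by ring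

theorem lt_of_tan_bounds {τ α u : ℝ} (hτ : 0 < τ) (hτ1 : τ < 1) (hα : 0 < α) (hα1 : α ≤ 1)
    (hu : 0 < u) (hατ : α * (1 - τ ^ 2) ≤ 2 * τ ^ 2)
    (huA : 2 * u * (1 - τ ^ 2) ≤ ((1 - τ) ^ 2 - 2 * α * τ) * (1 + u)) : u < 1 - τ - α := by
  have hτ2 : 0 < 1 - τ ^ 2 := by nlinarith
  have hA : 0 < (1 - τ) ^ 2 - 2 * α * τ :=
    pos_of_mul_pos_left ((by positivity : 0 < 2 * u * (1 - τ ^ 2)).trans_le huA) (by positivity)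
  have hlt := mul_lt_of_tan_bound hτ hτ1 hα (sub_pos.1 hA) hατ
  have hchain : 2 * u * (1 - τ ^ 2) * (2 - τ - α) < 2 * (1 - τ - α) * (1 - τ ^ 2) * (1 + u) := by
    calc 2 * u * (1 - τ ^ 2) * (2 - τ - α)
        ≤ ((1 - τ) ^ 2 - 2 * α * τ) * (1 + u) * (2 - τ - α) := by gcongr; linarith
      _ = (2 - τ - α) * ((1 - τ) ^ 2 - 2 * α * τ) * (1 + u) := by ring
      _ < 2 * (1 - τ - α) * (1 - τ ^ 2) * (1 + u) := mul_lt_mul_of_pos_right hlt (by positivity)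
  refine lt_of_mul_lt_mul_right ?_ (by positivity : 0 ≤ 2 * (1 - τ ^ 2))
  linarith

theorem one_lt_of_tan_bounds {τ α β C S : ℝ} (hτ : 0 < τ) (hτ1 : τ < 1) (hα : 0 < α)
    (hα1 : α ≤ 1) (hC : 0 < C) (hS : 0 < S) (hCS : C ^ 2 + S ^ 2 = 1)
    (hατ : α * (1 - τ ^ 2) ≤ 2 * τ ^ 2)
    (hβτ : (1 - β) * (1 - τ ^ 2) ≤ (1 - τ) ^ 2 - 2 * α * τ) (hβ : C + S * β ≤ 1) :
    1 < C * (1 - τ - α) + S := by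
  obtain ⟨u, hu, hu1, hSu, hCu⟩ := exists_half_tan hS hC ((add_comm _ _).trans hCS)
  have hτ2 : 0 < 1 - τ ^ 2 := by nlinarith
  have hβu : 2 * u ≤ (1 - β) * (1 + u) := by
    have hmul : (C + S * β) * (1 + u ^ 2) ≤ 1 * (1 + u ^ 2) := by gcongr
    refine le_of_mul_le_mul_right ?_ (sub_pos.2 hu1)
    linear_combination hmul - hCu - β * hSu
  have huA : 2 * u * (1 - τ ^ 2) ≤ ((1 - τ) ^ 2 - 2 * α * τ) * (1 + u) := by
    calc 2 * u * (1 - τ ^ 2) ≤ (1 - β) * (1 + u) * (1 - τ ^ 2) := by gcongr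
      _ = (1 - β) * (1 - τ ^ 2) * (1 + u) := by ring
      _ ≤ ((1 - τ) ^ 2 - 2 * α * τ) * (1 + u) := by gcongr
  have hlt : u < 1 - τ - α := lt_of_tan_bounds hτ hτ1 hα hα1 hu hατ huA
  refine lt_of_mul_lt_mul_right ?_ (by positivity : 0 ≤ 1 + u ^ 2)
  calc 1 * (1 + u ^ 2) = 2 * u * u + (1 - u ^ 2) := by ring
    _ < 2 * u * (1 - τ - α) + (1 - u ^ 2) := by gcongr
    _ = (C * (1 - τ - α) + S) * (1 + u ^ 2) := by
        linear_combination -(1 - τ - α) * hCu - hSu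

/-- The rotation of the plane about the origin by `i` counterclockwise quarter turns. -/
def turn (i : Fin 4) (z : ℝ × ℝ) : ℝ × ℝ :=
  ![z, (-z.2, z.1), (-z.1, -z.2), (z.2, -z.1)] i

/-- The reflection of the plane in the vertical axis. -/
def reflect (z : ℝ × ℝ) : ℝ × ℝ := (-z.1, z.2)

/-- The point with parameter `x ∈ [-1, 1]` on the `i`-th side of the square `[-1, 1]²`. The sides
are numbered and traversed counterclockwise starting with the lower one, so that
`sidePoint i (-1)` is the `i`-th vertex. -/
def sidePoint (i : Fin 4) (x : ℝ) : ℝ × ℝ := turn i (x, -1)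

theorem turn_turn (i j : Fin 4) (z : ℝ × ℝ) : turn i (turn j z) = turn (i + j) z := by
  fin_cases i <;> fin_cases j <;> simp [turn]

theorem turn_sidePoint (i j : Fin 4) (x : ℝ) : turn i (sidePoint j x) = sidePoint (i + j) x :=
  turn_turn i j _

theorem reflect_sidePoint (i : Fin 4) (x : ℝ) : reflect (sidePoint i x) = sidePoint (-i) (-x) := by
  fin_cases i <;> simp [reflect, sidePoint, turn]

theorem sidePoint_one (i : Fin 4) : sidePoint i 1 = sidePoint (i + 1) (-1) := by
  fin_cases i <;> simp [sidePoint, turn]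

theorem isLinearMap_turn (i : Fin 4) : IsLinearMap ℝ (turn i) := by
  constructor <;> intros <;> fin_cases i <;> simp [turn, add_comm]

theorem isLinearMap_reflect : IsLinearMap ℝ reflect := by
  constructor <;> intros <;> simp [reflect, add_comm]

theorem turn_mem_Icc (i : Fin 4) {z : ℝ × ℝ} (hz : z ∈ Icc (-1) 1) : turn i z ∈ Icc (-1) 1 := by
  obtain ⟨⟨h1, h2⟩, h3, h4⟩ := hz
  fin_cases i <;> simp_all [turn, Prod.le_def, neg_le]

theorem reflect_mem_Icc {z : ℝ × ℝ} (hz : z ∈ Icc (-1) 1) : reflect z ∈ Icc (-1) 1 := by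
  obtain ⟨⟨h1, h2⟩, h3, h4⟩ := hz
  simp_all [reflect, Prod.le_def, neg_le]

theorem sidePoint_mem_Icc (i : Fin 4) {x : ℝ} (hx : x ∈ Icc (-1) 1) :
    sidePoint i x ∈ Icc (-1) 1 :=
  turn_mem_Icc i ⟨⟨hx.1, le_rfl⟩, hx.2, by norm_num⟩

theorem sidePoint_add_one (i : Fin 4) (x : ℝ) : sidePoint (i + 1) x = turn i (1, x) := by
  fin_cases i <;> simp [sidePoint, turn]

theorem sidePoint_add_two (i : Fin 4) (x : ℝ) : sidePoint (i + 2) x = turn i (-x, 1) := by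
  fin_cases i <;> simp [sidePoint, turn]

theorem sidePoint_add_three (i : Fin 4) (x : ℝ) : sidePoint (i + 3) x = turn i (-1, -x) := by
  fin_cases i <;> simp [sidePoint, turn]

theorem sidePoint_eq_lineMap (i : Fin 4) :
    sidePoint i = AffineMap.lineMap (sidePoint i 0) (sidePoint i 1) := by
  ext x <;> fin_cases i <;> simp [sidePoint, turn, AffineMap.lineMap_apply]

theorem continuous_sidePoint (i : Fin 4) : Continuous (sidePoint i) := by
  rw [sidePoint_eq_lineMap]
  exact AffineMap.lineMap_continuous

/-- `K` fits into a closed unit square with sides directed along the unit vector `(c, s)` and along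
`(-s, c)`. This is encoded by bounding coordinate differences, which leaves the position of the
unit square implicit. -/
def FitsAlong (K : Set (ℝ × ℝ)) (c s : ℝ) : Prop :=
  ∀ x y x' y', (x, y) ∈ K → (x', y') ∈ K →
    c * (x' - x) + s * (y' - y) ≤ 1 ∧ c * (y' - y) - s * (x' - x) ≤ 1

/-- `K` is closed, convex and fits into a closed unit square none of whose sides is parallel to a
coordinate axis. By symmetry of the unit square, one of its directions can be taken in the open
first quadrant. -/
structure FitsTilted (K : Set (ℝ × ℝ)) : Prop where
  isClosed : IsClosed K
  convex : Convex ℝ K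
  exists_direction : ∃ c s : ℝ, 0 < c ∧ 0 < s ∧ c ^ 2 + s ^ 2 = 1 ∧ FitsAlong K c s

namespace FitsTilted

variable {K : Set (ℝ × ℝ)} {i : Fin 4} {x y : ℝ}

theorem preimage_turn (hK : FitsTilted K) (i : Fin 4) : FitsTilted (turn i ⁻¹' K) where
  isClosed := hK.isClosed.preimage
    (((isLinearMap_turn i).mk' _).continuous_of_finiteDimensional)
  convex := hK.convex.is_linear_preimage (isLinearMap_turn i)
  exists_direction := by
    obtain ⟨c, s, hc, hs, hcs, hw⟩ := hK.exists_direction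
    refine ⟨c, s, hc, hs, hcs, fun x y x' y' hz hz' => ?_⟩
    have hzz' := hw (turn i (x, y)).1 (turn i (x, y)).2 (turn i (x', y')).1 (turn i (x', y')).2
      hz hz'
    have hz'z := hw (turn i (x', y')).1 (turn i (x', y')).2 (turn i (x, y)).1 (turn i (x, y)).2
      hz' hz
    constructor <;> fin_cases i <;> simp [turn] at hzz' hz'z <;> linarith

theorem preimage_reflect (hK : FitsTilted K) : FitsTilted (reflect ⁻¹' K) where
  isClosed := hK.isClosed.preimage
    ((isLinearMap_reflect.mk' _).continuous_of_finiteDimensional)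
  convex := hK.convex.is_linear_preimage isLinearMap_reflect
  exists_direction := by
    obtain ⟨c, s, hc, hs, hcs, hw⟩ := hK.exists_direction
    refine ⟨s, c, hs, hc, by rwa [add_comm], fun x y x' y' hz hz' => ?_⟩
    have hzz' := hw _ _ _ _ hz hz'
    have hz'z := hw _ _ _ _ hz' hz
    simp only at hzz' hz'z
    constructor <;> linarith

theorem height_lt_two (hK : FitsTilted K) {x' y' : ℝ} (h : (x, y) ∈ K) (h' : (x', y') ∈ K) :
    y' - y < 2 := by
  obtain ⟨c, s, hc, hs, hcs, hw⟩ := hK.exists_direction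
  obtain ⟨hc1, hs1⟩ := lt_one_and_lt_one_of_sq_add_sq_eq_one hc hs hcs
  obtain ⟨h1, h2⟩ := hw x y x' y' h h'
  calc y' - y = s * (c * (x' - x) + s * (y' - y)) + c * (c * (y' - y) - s * (x' - x)) := by
        linear_combination (y - y') * hcs
    _ ≤ s * 1 + c * 1 := by gcongr
    _ < 2 := by linarith

theorem sidePoint_add_two_notMem (hK : FitsTilted K) (hx : sidePoint i x ∈ K) :
    sidePoint (i + 2) y ∉ K := by
  rw [sidePoint_add_two]
  intro hy
  linarith [(hK.preimage_turn i).height_lt_two hx hy]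

theorem eq_of_vertex_mem (hK : FitsTilted K) {i j : Fin 4} (hi : sidePoint i (-1) ∈ K)
    (hj : sidePoint j (-1) ∈ K) : i = j := by
  obtain rfl | rfl | rfl | rfl : j = i ∨ j = i + 1 ∨ j = i + 2 ∨ j = i + 3 := by grind
  · rfl
  · have hi' : sidePoint (i + 1 + 2) 1 ∈ K := by
      rwa [sidePoint_one, show i + 1 + 2 + 1 = i by grind]
    exact absurd hi' (hK.sidePoint_add_two_notMem hj)
  · exact absurd hj (hK.sidePoint_add_two_notMem hi)
  · have hj' : sidePoint (i + 2) 1 ∈ K := by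
      rwa [sidePoint_one, show i + 2 + 1 = i + 3 by grind]
    exact absurd hj' (hK.sidePoint_add_two_notMem hi)

theorem turn_notMem_of_vertex_mem (hK : FitsTilted K) (hi : sidePoint i (-1) ∈ K) (hx : 0 ≤ x)
    (hy : 0 ≤ y) : turn i (x, y) ∉ K := by
  intro hxy
  obtain ⟨c, s, hc, hs, hcs, hw⟩ := (hK.preimage_turn i).exists_direction
  have hle := (hw _ _ _ _ hi hxy).1
  have hcs1 : 1 < c + s := by nlinarith
  nlinarith

theorem sidePoint_add_three_notMem (hK : FitsTilted K) (hi : sidePoint i (-1) ∈ K)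
    (hx : sidePoint i x ∈ K) : sidePoint (i + 3) x ∉ K := by
  rw [sidePoint_add_three]
  intro hx'
  obtain ⟨c, s, hc, hs, hcs, hw⟩ := (hK.preimage_turn i).exists_direction
  have hbase : c * (1 + x) ≤ 1 := by linarith [(hw _ _ _ _ hi hx).1]
  have hside : s * (1 - x) ≤ 1 := by linarith [(hw _ _ _ _ hi hx').1]
  have hdiag : s * (1 + x) + c * (1 - x) ≤ 1 := by linarith [(hw _ _ _ _ hx hx').2]
  rcases le_total s c with hsc | hsc
  · exact (one_lt_of_mul_one_add_le_one hc hs hcs hsc hbase).not_ge hdiag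
  · linarith [one_lt_of_mul_one_add_le_one (x := -x) hs hc (by linarith) hsc (by linarith)]

theorem sidePoint_add_one_notMem (hK : FitsTilted K) (hx : sidePoint i x ∈ K) :
    sidePoint (i + 1) x ∉ K := by
  rw [sidePoint_add_one]
  intro hx'
  obtain ⟨c, s, hc, hs, hcs, hw⟩ := (hK.preimage_turn i).exists_direction
  obtain ⟨hle, hle'⟩ := hw _ _ _ _ hx hx'
  obtain ⟨hge, hge'⟩ := hw _ _ _ _ hx' hx
  have hsq : (c * (1 - x) + s * (1 + x)) ^ 2 ≤ 1 :=
    (sq_le_one_iff_abs_le_one _).2 (abs_le.2 ⟨by linarith, by linarith⟩)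
  have hsq' : (c * (1 + x) - s * (1 - x)) ^ 2 ≤ 1 :=
    (sq_le_one_iff_abs_le_one _).2 (abs_le.2 ⟨by linarith, by linarith⟩)
  obtain rfl : x = 0 := by
    have : (c ^ 2 + s ^ 2) * (2 + 2 * x ^ 2) ≤ 2 := by linarith
    rw [hcs] at this
    exact pow_eq_zero_iff two_ne_zero |>.1 (by linarith [sq_nonneg x])
  nlinarith [mul_pos hc hs]

theorem notMem_of_unit_base (hK : FitsTilted K) (h0 : (x, y) ∈ K) (h1 : (x + 1, y) ∈ K)
    (t : ℝ) : (t, y + 1) ∉ K := by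
  intro ht
  obtain ⟨c, s, hc, hs, hcs, hw⟩ := hK.exists_direction
  have h0t := (hw _ _ _ _ h0 ht).1
  have h1t := (hw _ _ _ _ h1 ht).2
  have hst : s * (c * (t - x)) ≤ s * (1 - s) := by gcongr; linarith
  have hct : c * (c + s - 1) ≤ c * (s * (t - x)) := by gcongr; linarith
  obtain ⟨hc1, hs1⟩ := lt_one_and_lt_one_of_sq_add_sq_eq_one hc hs hcs
  linarith [mul_pos (sub_pos.2 hc1) (sub_pos.2 hs1)]

theorem exists_mem_iff_le (hK : FitsTilted K) (hi : sidePoint i (-1) ∈ K) :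
    ∃ α ∈ Icc (-1) 1, ∀ x ∈ Icc (-1) 1, sidePoint i x ∈ K ↔ x ≤ α := by
  have hconv : Convex ℝ (sidePoint i ⁻¹' K) := by
    rw [sidePoint_eq_lineMap]
    exact hK.convex.affine_preimage _
  exact exists_forall_mem_iff_le_of_isClosed (hK.isClosed.preimage (continuous_sidePoint i))
    hconv.ordConnected (by norm_num) hi

theorem exists_mem_iff_ge (hK : FitsTilted K) (hi : sidePoint i 1 ∈ K) :
    ∃ β ∈ Icc (-1) 1, ∀ x ∈ Icc (-1) 1, sidePoint i x ∈ K ↔ β ≤ x := by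
  have hr (x : ℝ) : reflect (sidePoint (-i) (-x)) = sidePoint i x := by
    rw [reflect_sidePoint, neg_neg, neg_neg]
  obtain ⟨α, hα, h⟩ := hK.preimage_reflect.exists_mem_iff_le (i := -i) (by rwa [mem_preimage, hr])
  refine ⟨-α, ⟨neg_le_neg hα.2, neg_le.1 hα.1⟩, fun x hx => ?_⟩
  rw [neg_le, ← h (-x) ⟨neg_le_neg hx.2, neg_le.1 hx.1⟩, mem_preimage, hr]

end FitsTilted

/-- A cover of `[-1, 1]²` by five tilted pieces of which `K i` holds the `i`-th vertex; `E` is the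
piece left over. -/
structure CornerCover (K : Fin 4 → Set (ℝ × ℝ)) (E : Set (ℝ × ℝ)) : Prop where
  fits : ∀ i, FitsTilted (K i)
  fits_center : FitsTilted E
  vertex_mem : ∀ i, sidePoint i (-1) ∈ K i
  cover : Icc (-1) 1 ⊆ (⋃ i, K i) ∪ E

/-- The pieces at the two endpoints of the `i`-th side of `[-1, 1]²` cover this side. -/
def SideCovered (K : Fin 4 → Set (ℝ × ℝ)) (i : Fin 4) : Prop :=
  ∀ x ∈ Icc (-1) 1, sidePoint i x ∈ K i ∨ sidePoint i x ∈ K (i + 1)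

/-- The reach of the corner pieces: on the `i`-th side, `K i` covers the parameters up to `α i` and
`K (i + 1)` those from `β i` on. The field `lt` says that the two segments which a corner piece
cuts out of the sides at its vertex are together shorter than a side. -/
structure IsReach (K : Fin 4 → Set (ℝ × ℝ)) (α β : Fin 4 → ℝ) : Prop where
  neg_one_le : ∀ i, -1 ≤ α i
  le_one : ∀ i, β i ≤ 1
  lt : ∀ i, α (i + 1) < β i
  mem_iff : ∀ i, ∀ x ∈ Icc (-1) 1, sidePoint i x ∈ K i ↔ x ≤ α i
  mem_succ_iff : ∀ i, ∀ x ∈ Icc (-1) 1, sidePoint i x ∈ K (i + 1) ↔ β i ≤ x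

namespace CornerCover

variable {K : Fin 4 → Set (ℝ × ℝ)} {E : Set (ℝ × ℝ)}

theorem sidePoint_one_mem (h : CornerCover K E) (i : Fin 4) : sidePoint i 1 ∈ K (i + 1) :=
  sidePoint_one i ▸ h.vertex_mem (i + 1)

theorem preimage_turn (h : CornerCover K E) (i : Fin 4) :
    CornerCover (fun j => turn i ⁻¹' K (i + j)) (turn i ⁻¹' E) where
  fits j := (h.fits (i + j)).preimage_turn i
  fits_center := h.fits_center.preimage_turn i
  vertex_mem j := by
    rw [mem_preimage, turn_sidePoint]
    exact h.vertex_mem (i + j)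
  cover z hz := by
    rcases h.cover (turn_mem_Icc i hz) with hK | hE
    · obtain ⟨j, hj⟩ := mem_iUnion.1 hK
      exact .inl (mem_iUnion.2 ⟨j - i, by rwa [add_sub_cancel]⟩)
    · exact .inr hE

theorem preimage_reflect (h : CornerCover K E) :
    CornerCover (fun j => reflect ⁻¹' K (1 - j)) (reflect ⁻¹' E) where
  fits j := (h.fits (1 - j)).preimage_reflect
  fits_center := h.fits_center.preimage_reflect
  vertex_mem j := by
    rw [mem_preimage, reflect_sidePoint, neg_neg, sub_eq_neg_add]
    exact h.sidePoint_one_mem (-j)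
  cover z hz := by
    rcases h.cover (reflect_mem_Icc hz) with hK | hE
    · obtain ⟨j, hj⟩ := mem_iUnion.1 hK
      exact .inl (mem_iUnion.2 ⟨1 - j, by rwa [sub_sub_cancel]⟩)
    · exact .inr hE

theorem exists_isReach (h : CornerCover K E) : ∃ α β, IsReach K α β := by
  choose α hα hαmem using fun i => (h.fits i).exists_mem_iff_le (h.vertex_mem i)
  choose β hβ hβmem using fun i => (h.fits (i + 1)).exists_mem_iff_ge (h.sidePoint_one_mem i)
  refine ⟨α, β, fun i => (hα i).1, fun i => (hβ i).2, fun i => ?_, hαmem, hβmem⟩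
  have hmem : sidePoint (i + 1) (α (i + 1)) ∈ K (i + 1) := (hαmem _ _ (hα _)).2 le_rfl
  have hnotMem := (h.fits (i + 1)).sidePoint_add_three_notMem (h.vertex_mem _) hmem
  rw [show i + 1 + 3 = i by grind, hβmem i _ (hα _)] at hnotMem
  exact not_le.1 hnotMem

theorem sidePoint_mem (h : CornerCover K E) (i : Fin 4) {x : ℝ} (hx : x ∈ Icc (-1) 1) :
    sidePoint i x ∈ K i ∨ sidePoint i x ∈ K (i + 1) ∨ sidePoint i x ∈ E := by
  have hopp (j : Fin 4) (y : ℝ) (hy : sidePoint (i + 2) y ∈ K j) : sidePoint i x ∉ K j :=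
    fun hx => (h.fits j).sidePoint_add_two_notMem hx hy
  rcases h.cover (sidePoint_mem_Icc i hx) with hK | hE
  · obtain ⟨j, hj⟩ := mem_iUnion.1 hK
    obtain rfl | rfl | rfl | rfl : j = i ∨ j = i + 1 ∨ j = i + 2 ∨ j = i + 3 := by grind
    · exact .inl hj
    · exact .inr (.inl hj)
    · exact absurd hj (hopp _ _ (h.vertex_mem (i + 2)))
    · exact absurd hj (hopp _ _ (by simpa [add_assoc] using h.sidePoint_one_mem (i + 2)))
  · exact .inr (.inr hE)

end CornerCover

namespace IsReach

variable {K : Fin 4 → Set (ℝ × ℝ)} {E : Set (ℝ × ℝ)} {α β : Fin 4 → ℝ} {i : Fin 4}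

theorem sideCovered_iff (hr : IsReach K α β) : SideCovered K i ↔ β i ≤ α i := by
  constructor
  · refine fun hi => le_of_forall_Icc_le_or_ge (hr.neg_one_le i) (hr.le_one i) fun x hx => ?_
    exact (hi x hx).imp (hr.mem_iff i x hx).1 (hr.mem_succ_iff i x hx).1
  · intro hle x hx
    rw [hr.mem_iff i x hx, hr.mem_succ_iff i x hx]
    exact (le_total x (α i)).imp id hle.trans

theorem sidePoint_mem_of_mem_Icc (hr : IsReach K α β) (h : CornerCover K E)
    (hi : ¬ SideCovered K i) {x : ℝ} (hx : x ∈ Icc (α i) (β i)) : sidePoint i x ∈ E := by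
  rw [hr.sideCovered_iff, not_le] at hi
  refine Icc_subset_of_Ioo_subset_of_isClosed
    (h.fits_center.isClosed.preimage (continuous_sidePoint i)) hi (fun y hy => ?_) hx
  have hy1 : y ∈ Icc (-1) 1 :=
    ⟨(hr.neg_one_le i).trans hy.1.le, hy.2.le.trans (hr.le_one i)⟩
  rcases h.sidePoint_mem i hy1 with hK | hK | hE
  · exact absurd ((hr.mem_iff i y hy1).1 hK) hy.1.not_ge
  · exact absurd ((hr.mem_succ_iff i y hy1).1 hK) hy.2.not_ge
  · exact hE

end IsReach

namespace CornerCover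

variable {K : Fin 4 → Set (ℝ × ℝ)} {E : Set (ℝ × ℝ)}

theorem sideCovered_or_sideCovered_add_two (h : CornerCover K E) (i : Fin 4) :
    SideCovered K i ∨ SideCovered K (i + 2) := by
  obtain ⟨α, β, hr⟩ := h.exists_isReach
  by_contra! ⟨hi, hi2⟩
  have hlt := not_le.1 (hr.sideCovered_iff.not.1 hi)
  have hlt2 := not_le.1 (hr.sideCovered_iff.not.1 hi2)
  exact h.fits_center.sidePoint_add_two_notMem
    (hr.sidePoint_mem_of_mem_Icc h hi (left_mem_Icc.2 hlt.le))
    (hr.sidePoint_mem_of_mem_Icc h hi2 (left_mem_Icc.2 hlt2.le))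

theorem exists_sideCovered_sideCovered_add_one (h : CornerCover K E) :
    ∃ i, SideCovered K i ∧ SideCovered K (i + 1) := by
  rcases h.sideCovered_or_sideCovered_add_two 0 with h0 | h2 <;>
    rcases h.sideCovered_or_sideCovered_add_two 1 with h1 | h3
  exacts [⟨0, h0, h1⟩, ⟨3, h3, h0⟩, ⟨1, h1, h2⟩, ⟨2, h2, h3⟩]

theorem sideCovered_add_two_or_add_three (h : CornerCover K E) {i : Fin 4}
    (h0 : SideCovered K i) (h1 : SideCovered K (i + 1)) :
    SideCovered K (i + 2) ∨ SideCovered K (i + 3) := by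
  obtain ⟨α, β, hr⟩ := h.exists_isReach
  by_contra! ⟨h2, h3⟩
  have lt_succ (j : Fin 4) : α (i + (j + 1)) < β (i + j) := add_assoc i j 1 ▸ hr.lt (i + j)
  have h2lt : α (i + 2) < β (i + 2) := not_le.1 (hr.sideCovered_iff.not.1 h2)
  have h3lt : α (i + 3) < β (i + 3) := not_le.1 (hr.sideCovered_iff.not.1 h3)
  have h23 : α (i + 2) < β (i + 3) := by
    calc α (i + 2) < β (i + 1) := lt_succ 1
      _ ≤ α (i + 1) := hr.sideCovered_iff.1 h1
      _ < β i := hr.lt i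
      _ ≤ α i := hr.sideCovered_iff.1 h0
      _ < β (i + 3) := by simpa using lt_succ 3
  have h32 : α (i + 3) < β (i + 2) := lt_succ 2
  obtain ⟨x, hx2, hx3⟩ : ∃ x, x ∈ Icc (α (i + 2)) (β (i + 2)) ∧ x ∈ Icc (α (i + 3)) (β (i + 3)) :=
    ⟨max (α (i + 2)) (α (i + 3)), ⟨le_max_left _ _, max_le h2lt.le h32.le⟩,
      le_max_right _ _, max_le h23.le h3lt.le⟩
  refine h.fits_center.sidePoint_add_one_notMem (hr.sidePoint_mem_of_mem_Icc h h2 hx2) ?_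
  rw [show i + 2 + 1 = i + 3 by grind]
  exact hr.sidePoint_mem_of_mem_Icc h h3 hx3

end CornerCover

theorem FitsAlong.tan_bounds {K : Set (ℝ × ℝ)} {α β c s τ : ℝ} (hfit : FitsAlong K c s)
    (hcτ : c * (1 + τ ^ 2) = 1 - τ ^ 2) (hsτ : s * (1 + τ ^ 2) = 2 * τ) (hvertex : (-1, 1) ∈ K)
    (hleft : (-1, -α) ∈ K) (htop : (-β, 1) ∈ K) :
    α * (1 - τ ^ 2) ≤ 2 * τ ^ 2 ∧ (1 - β) * (1 - τ ^ 2) ≤ (1 - τ) ^ 2 - 2 * α * τ := by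
  have hheight : c * (1 + α) * (1 + τ ^ 2) ≤ 1 * (1 + τ ^ 2) := by
    gcongr
    linarith [(hfit _ _ _ _ hleft hvertex).2]
  have hdiag : (c * (1 - β) + s * (1 + α)) * (1 + τ ^ 2) ≤ 1 * (1 + τ ^ 2) := by
    gcongr
    linarith [(hfit _ _ _ _ hleft htop).1]
  constructor
  · linear_combination hheight - (1 + α) * hcτ
  · linear_combination hdiag - (1 - β) * hcτ - (1 + α) * hsτ

theorem IsReach.lt_of_three_sides {K : Fin 4 → Set (ℝ × ℝ)} {α β : Fin 4 → ℝ}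
    (hr : IsReach K α β) (h3 : SideCovered K 3) (h0 : SideCovered K 0) (h1 : SideCovered K 1) :
    α 0 < α 3 ∧ α 2 < α 3 ∧ α 3 < β 2 := by
  have h03 : α 0 < α 3 := (hr.lt 3).trans_le (hr.sideCovered_iff.1 h3)
  refine ⟨h03, ?_, hr.lt 2⟩
  calc α 2 < β 1 := hr.lt 1
    _ ≤ α 1 := hr.sideCovered_iff.1 h1
    _ < β 0 := hr.lt 0
    _ ≤ α 0 := hr.sideCovered_iff.1 h0
    _ < α 3 := h03

namespace CornerCover

variable {K : Fin 4 → Set (ℝ × ℝ)} {E : Set (ℝ × ℝ)}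

theorem midline_mem (h : CornerCover K E) (h0 : sidePoint 0 0 ∈ K 0) {c s τ : ℝ} (hs : 0 < s)
    (hτ0 : 0 < τ) (hτ : τ < 1) (hsτ : s * τ = 1 - c) (hfit : FitsAlong (K 3) c s) {x : ℝ}
    (hx : x ∈ Icc (τ - 1) 0) : (x, 0) ∈ E := by
  refine Icc_subset_of_Ioo_subset_of_isClosed (h.fits_center.isClosed.preimage
    (continuous_id.prodMk continuous_const)) (sub_neg.2 hτ) (fun y hy => ?_) hx
  have hy0 : 0 ≤ -y := neg_nonneg.2 hy.2.le
  have hy1 : (y, (0 : ℝ)) ∈ Icc (-1) 1 := by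
    constructor <;> constructor <;> simp <;> linarith [hy.1]
  refine (h.cover hy1).resolve_left fun hK => ?_
  obtain ⟨j, hj⟩ := mem_iUnion.1 hK
  fin_cases j
  · refine (h.fits 0).notMem_of_unit_base (h.vertex_mem 0) ?_ y (by simpa using hj)
    simpa [sidePoint, turn] using h0
  · refine (h.fits 1).turn_notMem_of_vertex_mem (h.vertex_mem 1) le_rfl hy0 ?_
    simpa [turn] using hj
  · refine (h.fits 2).turn_notMem_of_vertex_mem (h.vertex_mem 2) hy0 le_rfl ?_
    simpa [turn] using hj
  · have hvertex : (-1, 1) ∈ K 3 := by simpa [sidePoint, turn] using h.vertex_mem 3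
    have hle : s * (y + 1) ≤ s * τ := by
      linarith [(hfit _ _ _ _ hj hvertex).2]
    linarith [hy.1, le_of_mul_le_mul_left hle hs]

theorem sidePoint_zero_zero_notMem (h : CornerCover K E) (h3 : SideCovered K 3)
    (h0 : SideCovered K 0) (h1 : SideCovered K 1) : sidePoint 0 0 ∉ K 0 := by
  intro h00
  obtain ⟨α, β, hr⟩ := h.exists_isReach
  obtain ⟨h03, h23, h32⟩ := hr.lt_of_three_sides h3 h0 h1
  have hα3 : 0 < α 3 := ((hr.mem_iff 0 0 (by norm_num)).1 h00).trans_lt h03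
  have hα31 : α 3 ≤ 1 := h32.le.trans (hr.le_one 2)
  obtain ⟨c, s, hc, hs, hcs, hfit⟩ := (h.fits 3).exists_direction
  obtain ⟨C, S, hC, hS, hCS, hfitE⟩ := h.fits_center.exists_direction
  obtain ⟨τ, hτ, hτ1, hcτ, hsτ⟩ := exists_half_tan hc hs hcs
  have hsτc : s * τ = 1 - c := by
    refine mul_right_cancel₀ (by positivity : 1 + τ ^ 2 ≠ 0) ?_
    linear_combination τ * hsτ + hcτ
  have hvertex : (-1, 1) ∈ K 3 := by simpa [sidePoint, turn] using h.vertex_mem 3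
  have hleft : (-1, -α 3) ∈ K 3 := (hr.mem_iff 3 _ ⟨by linarith, hα31⟩).2 le_rfl
  have htop : (-β 2, 1) ∈ K 3 := by
    simpa [sidePoint, turn] using (hr.mem_succ_iff 2 (β 2) ⟨by linarith, hr.le_one 2⟩).2 le_rfl
  have h2 : ¬ SideCovered K 2 := fun h2 => (h23.trans h32).not_ge (hr.sideCovered_iff.1 h2)
  have htopE {x : ℝ} (hx : x ∈ Icc (α 2) (β 2)) : (-x, 1) ∈ E := by
    simpa [sidePoint, turn] using hr.sidePoint_mem_of_mem_Icc h h2 hx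
  have hmidE {x : ℝ} (hx : x ∈ Icc (τ - 1) 0) : (x, 0) ∈ E :=
    h.midline_mem h00 hs hτ hτ1 hsτc hfit hx
  obtain ⟨hατ, hβτ⟩ := hfit.tan_bounds hcτ hsτ hvertex hleft htop
  have hright : C + S * β 2 ≤ 1 := by
    linarith [(hfitE _ _ _ _ (hmidE ⟨by linarith, le_rfl⟩)
      (htopE ⟨(h23.trans h32).le, le_rfl⟩)).2]
  refine (one_lt_of_tan_bounds hτ hτ1 hα3 hα31 hC hS hCS hατ hβτ hright).not_ge ?_
  calc C * (1 - τ - α 3) + S ≤ C * (-α 3 - (τ - 1)) + S * (1 - 0) := by linarith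
    _ ≤ 1 := (hfitE _ _ _ _ (hmidE ⟨le_rfl, by linarith⟩) (htopE ⟨h23.le, h32.le⟩)).1

theorem sideCovered_preimage_turn {i j : Fin 4} :
    SideCovered (fun k => turn i ⁻¹' K (i + k)) j ↔ SideCovered K (i + j) := by
  simp only [SideCovered, mem_preimage, turn_sidePoint, add_assoc]

theorem sideCovered_preimage_reflect {j : Fin 4} :
    SideCovered (fun k => reflect ⁻¹' K (1 - k)) j ↔ SideCovered K (-j) := by
  have hneg (x : ℝ) (hx : x ∈ Icc (-1) 1) : -x ∈ Icc (-1 : ℝ) 1 :=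
    ⟨neg_le_neg hx.2, neg_le.1 hx.1⟩
  simp only [SideCovered, mem_preimage, reflect_sidePoint, show 1 - (j + 1) = -j by grind,
    show 1 - j = -j + 1 by grind]
  constructor
  · intro h x hx
    simpa [or_comm] using h (-x) (hneg x hx)
  · intro h x hx
    exact (h (-x) (hneg x hx)).symm

theorem not_sideCovered_three_zero_one (h : CornerCover K E) (h3 : SideCovered K 3)
    (h0 : SideCovered K 0) : ¬ SideCovered K 1 := by
  intro h1
  rcases h0 0 (by norm_num) with h00 | h01
  · exact h.sidePoint_zero_zero_notMem h3 h0 h1 h00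
  · refine h.preimage_reflect.sidePoint_zero_zero_notMem
      (sideCovered_preimage_reflect.2 h1) (sideCovered_preimage_reflect.2 h0)
      (sideCovered_preimage_reflect.2 h3) ?_
    simpa [reflect_sidePoint] using h01

theorem not_sideCovered_add_two (h : CornerCover K E) {i : Fin 4} (h0 : SideCovered K i)
    (h1 : SideCovered K (i + 1)) : ¬ SideCovered K (i + 2) := by
  intro h2
  refine (h.preimage_turn (i + 1)).not_sideCovered_three_zero_one ?_ ?_ ?_ <;>
    rw [sideCovered_preimage_turn]
  · rwa [show i + 1 + 3 = i by grind]
  · rwa [add_zero]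
  · rwa [show i + 1 + 1 = i + 2 by grind]

end CornerCover

theorem not_cornerCover {K : Fin 4 → Set (ℝ × ℝ)} {E : Set (ℝ × ℝ)} : ¬ CornerCover K E := by
  intro h
  obtain ⟨i, h0, h1⟩ := h.exists_sideCovered_sideCovered_add_one
  rcases h.sideCovered_add_two_or_add_three h0 h1 with h2 | h3
  · exact h.not_sideCovered_add_two h0 h1 h2
  · have h4 : SideCovered K (i + 3 + 1) := by rwa [show i + 3 + 1 = i by grind]
    exact h.not_sideCovered_add_two h3 h4 (by rwa [show i + 3 + 2 = i + 1 by grind])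

theorem not_Icc_subset_iUnion_of_fitsTilted {K : Fin 5 → Set (ℝ × ℝ)}
    (hK : ∀ i, FitsTilted (K i)) : ¬ Icc (-1) 1 ⊆ ⋃ i, K i := by
  intro hcover
  have hvertex (i : Fin 4) : ∃ j, sidePoint i (-1) ∈ K j :=
    mem_iUnion.1 (hcover (sidePoint_mem_Icc i (by norm_num)))
  choose f hf using hvertex
  have hinj : Function.Injective f := fun i j hij =>
    (hK (f i)).eq_of_vertex_mem (hf i) (hij ▸ hf j)
  obtain ⟨k, hk⟩ := exists_forall_mem_range_or_eq hinj (by simp)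
  refine not_cornerCover (K := K ∘ f) (E := K k) ⟨fun i => hK (f i), hK k, hf, fun z hz => ?_⟩
  obtain ⟨j, hj⟩ := mem_iUnion.1 (hcover hz)
  rcases hk j with ⟨i, rfl⟩ | rfl
  · exact .inl (mem_iUnion.2 ⟨i, hj⟩)
  · exact .inr hj

namespace PlaneSquare

open scoped RealInnerProductSpace

theorem exists_orthonormalBasis (Q : PlaneSquare) :
    ∃ b : OrthonormalBasis (Fin 2) ℝ (EuclideanSpace ℝ (Fin 2)), ⇑b = ![Q.u, Q.v] := by
  have hon : Orthonormal ℝ ![Q.u, Q.v] := by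
    rw [orthonormal_vecCons_iff]
    simp [Q.norm_u, Q.norm_v, Q.inner_u_v, Subsingleton.elim _ (0 : Fin 1)]
  refine ⟨OrthonormalBasis.mk hon ?_, OrthonormalBasis.coe_mk _ _⟩
  exact (hon.linearIndependent.span_eq_top_of_card_eq_finrank' (by simp)).ge

theorem inner_smul_add_inner_smul (Q : PlaneSquare) (w : EuclideanSpace ℝ (Fin 2)) :
    ⟪Q.u, w⟫ • Q.u + ⟪Q.v, w⟫ • Q.v = w := by
  obtain ⟨b, hb⟩ := Q.exists_orthonormalBasis
  simpa [hb] using b.sum_repr' w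

theorem inner_mul_inner_add (Q : PlaneSquare) (w w' : EuclideanSpace ℝ (Fin 2)) :
    ⟪Q.u, w⟫ * ⟪Q.u, w'⟫ + ⟪Q.v, w⟫ * ⟪Q.v, w'⟫ = ⟪w, w'⟫ := by
  conv_rhs => rw [← Q.inner_smul_add_inner_smul w]
  rw [inner_add_left, real_inner_smul_left, real_inner_smul_left]

theorem sq_inner_add_sq_inner (Q : PlaneSquare) (w : EuclideanSpace ℝ (Fin 2)) :
    ⟪Q.u, w⟫ ^ 2 + ⟪Q.v, w⟫ ^ 2 = ‖w‖ ^ 2 := by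
  rw [← real_inner_self_eq_norm_sq, ← Q.inner_mul_inner_add w w, sq, sq]

theorem u_ne_zero (Q : PlaneSquare) : Q.u ≠ 0 := norm_ne_zero_iff.1 (by simp [Q.norm_u])

theorem v_ne_zero (Q : PlaneSquare) : Q.v ≠ 0 := norm_ne_zero_iff.1 (by simp [Q.norm_v])

theorem span_singleton_eq_span_v {Q : PlaneSquare} {w : EuclideanSpace ℝ (Fin 2)} (hw : w ≠ 0)
    (h : ⟪Q.u, w⟫ = 0) : Submodule.span ℝ {w} = Submodule.span ℝ {Q.v} := by
  have hsmul : ⟪Q.v, w⟫ • Q.v = w := by simpa [h] using Q.inner_smul_add_inner_smul w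
  have hne : ⟪Q.v, w⟫ ≠ 0 := left_ne_zero_of_smul (hsmul ▸ hw)
  conv_lhs => rw [← hsmul]
  exact Submodule.span_singleton_smul_eq (IsUnit.mk0 _ hne) _

theorem span_singleton_eq_span_u {Q : PlaneSquare} {w : EuclideanSpace ℝ (Fin 2)} (hw : w ≠ 0)
    (h : ⟪Q.v, w⟫ = 0) : Submodule.span ℝ {w} = Submodule.span ℝ {Q.u} := by
  have hsmul : ⟪Q.u, w⟫ • Q.u = w := by simpa [h] using Q.inner_smul_add_inner_smul w
  have hne : ⟪Q.u, w⟫ ≠ 0 := left_ne_zero_of_smul (hsmul ▸ hw)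
  conv_lhs => rw [← hsmul]
  exact Submodule.span_singleton_smul_eq (IsUnit.mk0 _ hne) _

theorem sidesParallel_of_inner_eq_zero {G Q : PlaneSquare}
    (h : ⟪Q.u, G.u⟫ = 0 ∨ ⟪Q.v, G.u⟫ = 0) : G.SidesParallel Q := by
  rcases h with h | h
  · exact .inr ⟨span_singleton_eq_span_v G.u_ne_zero h,
      (span_singleton_eq_span_v Q.u_ne_zero ((real_inner_comm _ _).trans h)).symm⟩
  · exact .inl ⟨span_singleton_eq_span_u G.u_ne_zero h,
      (span_singleton_eq_span_v Q.v_ne_zero ((real_inner_comm _ _).trans h)).symm⟩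

theorem abs_inner_u_eq_abs_inner_v (G : PlaneSquare) {w w' : EuclideanSpace ℝ (Fin 2)}
    (hnorm : ‖w‖ = ‖w'‖) (horth : ⟪w, w'⟫ = 0) : |⟪G.u, w⟫| = |⟪G.v, w'⟫| := by
  rw [← sq_eq_sq_iff_abs_eq_abs]
  rcases eq_or_ne w 0 with rfl | hw
  · obtain rfl : w' = 0 := norm_eq_zero.1 (by rw [← hnorm, norm_zero])
    simp
  have horth' := (G.inner_mul_inner_add w w').trans horth
  have hw_sq := G.sq_inner_add_sq_inner w
  have hw'_sq := G.sq_inner_add_sq_inner w'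
  rw [← hnorm] at hw'_sq
  refine mul_left_cancel₀ (pow_ne_zero 2 (norm_ne_zero_iff.2 hw)) ?_
  linear_combination (⟪G.u, w⟫ * ⟪G.u, w'⟫ - ⟪G.v, w⟫ * ⟪G.v, w'⟫) * horth'
    + ⟪G.v, w'⟫ ^ 2 * hw_sq - ⟪G.u, w⟫ ^ 2 * hw'_sq

/-- The width of `G` in the direction `w`, that is, for a unit vector `w`, the length of the
orthogonal projection of `G` to the line spanned by `w`. -/
noncomputable def width (G : PlaneSquare) (w : EuclideanSpace ℝ (Fin 2)) : ℝ :=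
  G.side * (|⟪G.u, w⟫| + |⟪G.v, w⟫|)

theorem width_congr (G : PlaneSquare) {w w' : EuclideanSpace ℝ (Fin 2)}
    (hnorm : ‖w‖ = ‖w'‖) (horth : ⟪w, w'⟫ = 0) : G.width w' = G.width w := by
  rw [width, width, G.abs_inner_u_eq_abs_inner_v hnorm horth,
    G.abs_inner_u_eq_abs_inner_v hnorm.symm ((real_inner_comm _ _).trans horth), add_comm]

theorem inner_sub_le_width {G : PlaneSquare} {p p' : EuclideanSpace ℝ (Fin 2)}
    (hp : p ∈ G.carrier) (hp' : p' ∈ G.carrier) (w : EuclideanSpace ℝ (Fin 2)) :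
    ⟪p' - p, w⟫ ≤ G.width w := by
  obtain ⟨x, y, hx, hxG, hy, hyG, rfl⟩ := hp
  obtain ⟨x', y', hx', hxG', hy', hyG', rfl⟩ := hp'
  have hdx : |x' - x| ≤ G.side := abs_le.2 ⟨by linarith, by linarith⟩
  have hdy : |y' - y| ≤ G.side := abs_le.2 ⟨by linarith, by linarith⟩
  calc ⟪G.corner + x' • G.u + y' • G.v - (G.corner + x • G.u + y • G.v), w⟫
      = (x' - x) * ⟪G.u, w⟫ + (y' - y) * ⟪G.v, w⟫ := by
        simp only [inner_sub_left, inner_add_left, real_inner_smul_left]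
        ring
    _ ≤ |x' - x| * |⟪G.u, w⟫| + |y' - y| * |⟪G.v, w⟫| := by
        rw [← abs_mul, ← abs_mul]
        exact add_le_add (le_abs_self _) (le_abs_self _)
    _ ≤ G.side * |⟪G.u, w⟫| + G.side * |⟪G.v, w⟫| := by gcongr
    _ = G.width w := (mul_add _ _ _).symm

/-- The similarity taking the square `[-1, 1]²` to `Q` and its sides to those of `Q`. -/
noncomputable def chart (Q : PlaneSquare) : ℝ × ℝ →ᵃ[ℝ] EuclideanSpace ℝ (Fin 2) :=
  ((LinearMap.fst ℝ ℝ ℝ).smulRight ((Q.side / 2) • Q.u) +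
    (LinearMap.snd ℝ ℝ ℝ).smulRight ((Q.side / 2) • Q.v)).toAffineMap +
    AffineMap.const ℝ (ℝ × ℝ) (Q.corner + (Q.side / 2) • (Q.u + Q.v))

theorem chart_apply (Q : PlaneSquare) (z : ℝ × ℝ) : Q.chart z =
    Q.corner + (Q.side / 2 * (z.1 + 1)) • Q.u + (Q.side / 2 * (z.2 + 1)) • Q.v := by
  simp only [chart, AffineMap.coe_add, Pi.add_apply, LinearMap.coe_toAffineMap,
    LinearMap.add_apply, LinearMap.smulRight_apply, LinearMap.fst_apply, LinearMap.snd_apply,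
    AffineMap.const_apply]
  module

theorem image_chart (Q : PlaneSquare) : Q.chart '' Icc (-1) 1 = Q.carrier := by
  have hside := Q.side_pos
  ext p
  constructor
  · rintro ⟨z, ⟨⟨hx, hy⟩, hx', hy'⟩, rfl⟩
    simp only [Prod.fst_neg, Prod.snd_neg, Prod.fst_one, Prod.snd_one] at hx hy hx' hy'
    refine ⟨_, _, ?_, ?_, ?_, ?_, Q.chart_apply z⟩ <;> nlinarith
  · rintro ⟨x, y, hx, hxQ, hy, hyQ, rfl⟩
    have hx0 : 0 ≤ x / Q.side := by positivity
    have hy0 : 0 ≤ y / Q.side := by positivity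
    have hx1 : x / Q.side ≤ 1 := (div_le_one hside).2 hxQ
    have hy1 : y / Q.side ≤ 1 := (div_le_one hside).2 hyQ
    have hmem : (2 * (x / Q.side) - 1, 2 * (y / Q.side) - 1) ∈ Icc (-1 : ℝ × ℝ) 1 := by
      constructor <;> constructor <;> simp <;> linarith
    refine ⟨_, hmem, ?_⟩
    rw [chart_apply]
    congr <;> field_simp <;> ring

theorem isClosed_carrier (Q : PlaneSquare) : IsClosed Q.carrier := by
  rw [← image_chart]
  exact (isCompact_Icc.image Q.chart.continuous_of_finiteDimensional).isClosed

theorem convex_carrier (Q : PlaneSquare) : Convex ℝ Q.carrier := by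
  rw [← image_chart]
  exact (convex_Icc _ _).affine_image _

theorem inner_chart_sub_chart (Q : PlaneSquare) (z z' : ℝ × ℝ) (w : EuclideanSpace ℝ (Fin 2)) :
    ⟪Q.chart z' - Q.chart z, w⟫ =
      Q.side / 2 * (⟪Q.u, w⟫ * (z'.1 - z.1) + ⟪Q.v, w⟫ * (z'.2 - z.2)) := by
  simp only [chart_apply, inner_sub_left, inner_add_left, real_inner_smul_left]
  ring

/-- The quarter turn of `w` in the orientation of the plane for which `Q.v` is the quarter turn of
`Q.u`. -/
noncomputable def perp (Q : PlaneSquare) (w : EuclideanSpace ℝ (Fin 2)) :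
    EuclideanSpace ℝ (Fin 2) :=
  ⟪Q.u, w⟫ • Q.v - ⟪Q.v, w⟫ • Q.u

theorem inner_u_perp (Q : PlaneSquare) (w : EuclideanSpace ℝ (Fin 2)) :
    ⟪Q.u, Q.perp w⟫ = -⟪Q.v, w⟫ := by
  simp [perp, inner_sub_right, real_inner_smul_right, Q.norm_u, Q.inner_u_v]

theorem inner_v_perp (Q : PlaneSquare) (w : EuclideanSpace ℝ (Fin 2)) :
    ⟪Q.v, Q.perp w⟫ = ⟪Q.u, w⟫ := by
  simp [perp, inner_sub_right, real_inner_smul_right, Q.norm_v, real_inner_comm Q.u Q.v,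
    Q.inner_u_v]

theorem norm_perp (Q : PlaneSquare) (w : EuclideanSpace ℝ (Fin 2)) : ‖Q.perp w‖ = ‖w‖ := by
  rw [← sq_eq_sq₀ (norm_nonneg _) (norm_nonneg _), ← Q.sq_inner_add_sq_inner,
    ← Q.sq_inner_add_sq_inner w, inner_u_perp, inner_v_perp, neg_sq, add_comm]

theorem inner_perp (Q : PlaneSquare) (w : EuclideanSpace ℝ (Fin 2)) : ⟪w, Q.perp w⟫ = 0 := by
  rw [← Q.inner_mul_inner_add, inner_u_perp, inner_v_perp]
  ring

theorem fitsTilted_preimage_chart {G Q : PlaneSquare} {w : EuclideanSpace ℝ (Fin 2)}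
    (hw : ‖w‖ = 1) (hu : 0 < ⟪Q.u, w⟫) (hv : 0 < ⟪Q.v, w⟫) (hwidth : G.width w ≤ Q.side / 2) :
    FitsTilted (Q.chart ⁻¹' G.carrier) where
  isClosed := G.isClosed_carrier.preimage Q.chart.continuous_of_finiteDimensional
  convex := G.convex_carrier.affine_preimage Q.chart
  exists_direction := by
    refine ⟨⟪Q.u, w⟫, ⟪Q.v, w⟫, hu, hv, by rw [sq_inner_add_sq_inner, hw, one_pow],
      fun x y x' y' hz hz' => ?_⟩
    have hside : 0 < Q.side / 2 := half_pos Q.side_pos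
    have hwidth' : G.width (Q.perp w) ≤ Q.side / 2 :=
      (G.width_congr (Q.norm_perp w).symm (Q.inner_perp w)).trans_le hwidth
    have hle := (inner_sub_le_width hz hz' w).trans hwidth
    have hle' := (inner_sub_le_width hz hz' (Q.perp w)).trans hwidth'
    rw [inner_chart_sub_chart, mul_le_iff_le_one_right hside] at hle hle'
    rw [inner_u_perp, inner_v_perp] at hle'
    exact ⟨hle, by linarith⟩

theorem width_neg (G : PlaneSquare) (w : EuclideanSpace ℝ (Fin 2)) :
    G.width (-w) = G.width w := by
  simp only [width, inner_neg_right, abs_neg]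

theorem width_eq_side_of_inner_eq_zero {G : PlaneSquare} {w : EuclideanSpace ℝ (Fin 2)}
    (hw : ‖w‖ = 1) (h : ⟪G.u, w⟫ = 0) : G.width w = G.side := by
  have hv : |⟪G.v, w⟫| = 1 := by
    rw [← abs_one, ← sq_eq_sq_iff_abs_eq_abs, ← hw, ← G.sq_inner_add_sq_inner, h]
    ring
  rw [width, h, hv, abs_zero, zero_add, mul_one]

theorem width_v (G : PlaneSquare) : G.width G.v = G.side :=
  width_eq_side_of_inner_eq_zero G.norm_v G.inner_u_v

theorem width_u (G : PlaneSquare) : G.width G.u = G.side := by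
  rw [← G.width_v]
  exact (G.width_congr (G.norm_u.trans G.norm_v.symm) G.inner_u_v).symm

theorem exists_width_eq_of_mul_pos {G Q : PlaneSquare} {w : EuclideanSpace ℝ (Fin 2)}
    (h : 0 < ⟪Q.u, w⟫ * ⟪Q.v, w⟫) :
    ∃ w', ‖w'‖ = ‖w‖ ∧ 0 < ⟪Q.u, w'⟫ ∧ 0 < ⟪Q.v, w'⟫ ∧ G.width w' = G.width w := by
  rcases pos_and_pos_or_neg_and_neg_of_mul_pos h with ⟨hu, hv⟩ | ⟨hu, hv⟩
  · exact ⟨w, rfl, hu, hv, rfl⟩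
  · refine ⟨-w, norm_neg w, ?_, ?_, G.width_neg w⟩ <;> rwa [inner_neg_right, neg_pos]

theorem exists_width_eq_side {G Q : PlaneSquare} (hu : ⟪Q.u, G.u⟫ ≠ 0) (hv : ⟪Q.v, G.u⟫ ≠ 0) :
    ∃ w, ‖w‖ = 1 ∧ 0 < ⟪Q.u, w⟫ ∧ 0 < ⟪Q.v, w⟫ ∧ G.width w = G.side := by
  rcases (mul_ne_zero hu hv).lt_or_gt with hneg | hpos
  · have hsum : ⟪Q.u, G.u⟫ * ⟪Q.v, G.u⟫ + ⟪Q.u, G.v⟫ * ⟪Q.v, G.v⟫ = 0 := by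
      rw [← Q.inner_u_v, ← G.inner_mul_inner_add Q.u Q.v]
      simp only [real_inner_comm]
    rw [← G.norm_v, ← G.width_v]
    exact exists_width_eq_of_mul_pos (by linarith)
  · rw [← G.norm_u, ← G.width_u]
    exact exists_width_eq_of_mul_pos hpos

theorem exists_width_lt_of_width_u_lt {G Q : PlaneSquare} {a : ℝ} (h : G.width Q.u < a) :
    ∃ w, ‖w‖ = 1 ∧ 0 < ⟪Q.u, w⟫ ∧ 0 < ⟪Q.v, w⟫ ∧ G.width w < a := by
  have hcont : Continuous fun t => G.width (Real.cos t • Q.u + Real.sin t • Q.v) := by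
    unfold width
    fun_prop
  have hlt : ∀ᶠ t in 𝓝 0, G.width (Real.cos t • Q.u + Real.sin t • Q.v) < a :=
    hcont.continuousAt.eventually_lt continuousAt_const (by simpa using h)
  obtain ⟨t, ht, ht0, htpi⟩ := ((hlt.filter_mono nhdsWithin_le_nhds).and
    (Ioo_mem_nhdsGT (half_pos Real.pi_pos))).exists
  have hu : ⟪Q.u, Real.cos t • Q.u + Real.sin t • Q.v⟫ = Real.cos t := by
    simp [inner_add_right, real_inner_smul_right, Q.norm_u, Q.inner_u_v]
  have hv : ⟪Q.v, Real.cos t • Q.u + Real.sin t • Q.v⟫ = Real.sin t := by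
    simp [inner_add_right, real_inner_smul_right, Q.norm_v, real_inner_comm Q.u Q.v, Q.inner_u_v]
  refine ⟨_, ?_, ?_, ?_, ht⟩
  · rw [← sq_eq_sq₀ (norm_nonneg _) zero_le_one, ← Q.sq_inner_add_sq_inner, hu, hv, one_pow,
      Real.cos_sq_add_sin_sq]
  · rw [hu]
    exact Real.cos_pos_of_mem_Ioo ⟨by linarith, htpi⟩
  · rw [hv]
    exact Real.sin_pos_of_pos_of_lt_pi ht0 (by linarith)

theorem width_eq_side_of_inner_u_eq_zero {G Q : PlaneSquare}
    (h : ⟪Q.u, G.u⟫ = 0 ∨ ⟪Q.v, G.u⟫ = 0) : G.width Q.u = G.side := by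
  rcases h with h | h
  · exact width_eq_side_of_inner_eq_zero Q.norm_u ((real_inner_comm _ _).trans h)
  · rw [← G.width_congr (Q.norm_u.trans Q.norm_v.symm) Q.inner_u_v]
    exact width_eq_side_of_inner_eq_zero Q.norm_v ((real_inner_comm _ _).trans h)

theorem exists_width_le_half_side {G Q : PlaneSquare} (hle : 2 * G.side ≤ Q.side)
    (hpar : ¬ (2 * G.side = Q.side ∧ G.SidesParallel Q)) :
    ∃ w, ‖w‖ = 1 ∧ 0 < ⟪Q.u, w⟫ ∧ 0 < ⟪Q.v, w⟫ ∧ G.width w ≤ Q.side / 2 := by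
  by_cases hinner : ⟪Q.u, G.u⟫ = 0 ∨ ⟪Q.v, G.u⟫ = 0
  · have hlt : 2 * G.side < Q.side := lt_of_le_of_ne hle fun heq =>
      hpar ⟨heq, sidesParallel_of_inner_eq_zero hinner⟩
    have hwidth : G.width Q.u < Q.side / 2 := by
      linarith [width_eq_side_of_inner_u_eq_zero hinner]
    obtain ⟨w, hw, hu, hv, hlt'⟩ := exists_width_lt_of_width_u_lt hwidth
    exact ⟨w, hw, hu, hv, hlt'.le⟩
  · obtain ⟨hu, hv⟩ := not_or.1 hinner
    obtain ⟨w, hw, hwu, hwv, hwidth⟩ := exists_width_eq_side hu hv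
    exact ⟨w, hw, hwu, hwv, by linarith⟩

theorem exists_sidesParallel_of_subset_iUnion {Q : PlaneSquare} {F : Fin 5 → PlaneSquare}
    (hF : ∀ i, 2 * (F i).side ≤ Q.side) (hcover : Q.carrier ⊆ ⋃ i, (F i).carrier) :
    ∃ i, 2 * (F i).side = Q.side ∧ (F i).SidesParallel Q := by
  by_contra! hnot
  have hfits (i : Fin 5) : FitsTilted (Q.chart ⁻¹' (F i).carrier) := by
    obtain ⟨w, hw, hu, hv, hwidth⟩ :=
      exists_width_le_half_side (hF i) fun h => hnot i h.1 h.2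
    exact fitsTilted_preimage_chart hw hu hv hwidth
  refine not_Icc_subset_iUnion_of_fitsTilted hfits ?_
  rwa [← preimage_iUnion, ← image_subset_iff, image_chart]

/-- The square with edge length `a`, lower left vertex `p` and sides parallel to the axes. -/
noncomputable def axisSquare (p : EuclideanSpace ℝ (Fin 2)) {a : ℝ} (ha : 0 < a) :
    PlaneSquare where
  corner := p
  u := !₂[1, 0]
  v := !₂[0, 1]
  side := a
  norm_u := by simp [EuclideanSpace.norm_eq]
  norm_v := by simp [EuclideanSpace.norm_eq]
  inner_u_v := by simp [PiLp.inner_apply]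
  side_pos := ha

theorem mem_carrier_axisSquare {p q : EuclideanSpace ℝ (Fin 2)} {a : ℝ} {ha : 0 < a} :
    q ∈ (axisSquare p ha).carrier ↔ ∀ i, q i ∈ Icc (p i) (p i + a) := by
  constructor
  · rintro ⟨x, y, hx, hxa, hy, hya, rfl⟩ i
    simp only [axisSquare] at hxa hya
    fin_cases i <;> simp [axisSquare, *]
  · intro h
    refine ⟨q 0 - p 0, q 1 - p 1, sub_nonneg.2 (h 0).1, sub_le_iff_le_add'.2 (h 0).2,
      sub_nonneg.2 (h 1).1, sub_le_iff_le_add'.2 (h 1).2, ?_⟩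
    ext i
    fin_cases i <;> simp [axisSquare]

theorem two_mem_coverableLengths : 2 ∈ coverableLengths 5 := by
  refine ⟨axisSquare 0 two_pos, rfl, ![axisSquare !₂[0, 0] one_pos, axisSquare !₂[1, 0] one_pos,
    axisSquare !₂[0, 1] one_pos, axisSquare !₂[1, 1] one_pos, axisSquare 0 one_pos], ?_, ?_⟩
  · intro i
    fin_cases i <;> rfl
  · intro q hq
    have hhalf (i : Fin 2) : q i ∈ Icc 0 (0 + 1) ∨ q i ∈ Icc 1 (1 + 1) := by
      have hqi : q i ∈ Icc 0 (0 + 2) := mem_carrier_axisSquare.1 hq i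
      rw [zero_add] at hqi ⊢
      rw [one_add_one_eq_two]
      exact (le_total (q i) 1).imp (⟨hqi.1, ·⟩) (⟨·, hqi.2⟩)
    rw [mem_iUnion]
    rcases hhalf 0 with h0 | h0 <;> rcases hhalf 1 with h1 | h1
    · exact ⟨0, mem_carrier_axisSquare.2 (Fin.forall_fin_two.2 ⟨h0, h1⟩)⟩
    · exact ⟨2, mem_carrier_axisSquare.2 (Fin.forall_fin_two.2 ⟨h0, h1⟩)⟩
    · exact ⟨1, mem_carrier_axisSquare.2 (Fin.forall_fin_two.2 ⟨h0, h1⟩)⟩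
    · exact ⟨3, mem_carrier_axisSquare.2 (Fin.forall_fin_two.2 ⟨h0, h1⟩)⟩

end PlaneSquare

theorem theorem2_general :
    IsGreatest (PlaneSquare.coverableLengths 5) 2 ∧
    ∀ (Q : PlaneSquare) (F : Fin 5 → PlaneSquare), (∀ i, 2 * (F i).side ≤ Q.side) →
      Q.carrier ⊆ ⋃ i, (F i).carrier →
        ∃ i, 2 * (F i).side = Q.side ∧ PlaneSquare.SidesParallel (F i) Q := by
  refine ⟨⟨PlaneSquare.two_mem_coverableLengths, ?_⟩, fun Q F hF hcover =>
    PlaneSquare.exists_sidesParallel_of_subset_iUnion hF hcover⟩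
  rintro a ⟨Q, rfl, F, hunit, hcover⟩
  by_contra! hlt
  obtain ⟨i, hi, -⟩ := PlaneSquare.exists_sidesParallel_of_subset_iUnion (Q := Q) (F := F)
    (fun i => by linarith [hunit i]) hcover
  linarith [hunit i]

theorem theorem2 :
    IsGreatest (PlaneSquare.coverableLengths 5) 2 ∧
    ∀ (Q : PlaneSquare) (F : Fin 5 → PlaneSquare), Q.side = 2 → PlaneSquare.IsUnitCover F Q →
      ∃ i, PlaneSquare.SidesParallel (F i) Q := by
  refine theorem2_general.imp_right fun h Q F hQ hF => ?_
  exact (h Q F (fun i => by rw [hF.1 i, hQ, mul_one]) hF.2).imp fun _ hi => hi.2
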